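/- Let $d\ge 3$ be a fixed integer, and let $\lambda<d$, $\mu>0$ and $r\ge 1$ be fixed. Let $(G_k)_{k\ge1}$ be a sequence of finite simple $d$-regular graphs on $n_k$ vertices, with $n_k\to\infty$, such that all eigenvalues of the adjacency matrix of $G_k$ (counted with multiplicity) other than the largest one, $d$, are at most $\lambda$ in absolute value. Let $g_k\to\infty$ be integers such that the girth of $G_k$ is at least $g_k$, and let $v^{(k)}_1,\dots,v^{(k)}_r$ be vertices of $G_k$ whose pairwise distances are at least $g_k$. Let $m_k=\lfloor\mu n_k\rfloor$, and let $(w_0,w_1,\dots,w_{m_k})$ be a non-backtracking random walk of length $m_k$ on $G_k$ started at $w_0=v^{(k)}_1$: $w_1$ is uniform over the neighbors of $w_0$, and, for $i\ge2$, given $w_0,\dots,w_{i-1}$, the vertex $w_i$ is uniform over the neighbors of $w_{i-1}$ other than $w_{i-2}$. Let $X^{(k)}_i=|\{1\le j\le m_k: w_j=v^{(k)}_i\}|$ be the number of visits of the walk to $v^{(k)}_i$ (the start at time $0$ is not counted). Then, as $k\to\infty$, $(X^{(k)}_1,\dots,X^{(k)}_r)$ converges in distribution to $(Z_1,\dots,Z_r)$,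 where $Z_1,\dots,Z_r$ are independent Poisson random variables with mean $\mu$. -/

import Mathlib

open Filter MeasureTheory ProbabilityTheory
open scoped Topology NNReal

namespace SimpleGraph

/-- `G` is an `(n, d, lam)` graph: it has `n` vertices, it is `d`-regular, and, when the eigenvalues
`lam₁ ≥ lam₂ ≥ ⋯ ≥ lamₙ` of its adjacency matrix are listed in decreasing order and with
multiplicity, all of them but the first one are at most `lam` in absolute value.
(`Matrix.IsHermitian.eigenvalues₀` is that list, indexed from `0`.) -/
structure IsNDLambdaGraph {V : Type*} [Fintype V] [DecidableEq V] (G : SimpleGraph V)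
    [DecidableRel G.Adj] (n d : ℕ) (lam : ℝ) : Prop where
  card_eq : Fintype.card V = n
  regular : G.IsRegularOfDegree d
  abs_eigenvalue_le : ∀ i : Fin (Fintype.card V), 0 < (i : ℕ) →
    |(G.isHermitian_adjMatrix ℝ).eigenvalues₀ i| ≤ lam

section Walk

variable {V : Type*} [Fintype V] [DecidableEq V] (G : SimpleGraph V) [DecidableRel G.Adj]

/-- The vertices at which the walk `(w 0, …, w k)` may be continued without backtracking: the
neighbours of `w k`, except for `w (k - 1)` if `k ≥ 1`. -/
def nbChoices {k : ℕ} (w : Fin (k + 1) → V) : Finset V :=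
  {x ∈ G.neighborFinset (w (Fin.last k)) | ∀ j : Fin (k + 1), (j : ℕ) + 1 = k → x ≠ w j}

/-- The law of the next vertex of a non-backtracking random walk that has followed
`(w 0, …, w k)`: uniform over `nbChoices`. (If there is no choice, which does not occur when all
degrees are at least `2`, the walk stays where it is.) -/
noncomputable def nbNext {k : ℕ} (w : Fin (k + 1) → V) : PMF V :=
  if h : (G.nbChoices w).Nonempty then PMF.uniformOfFinset (G.nbChoices w) h
  else PMF.pure (w (Fin.last k))

/-- The law of the non-backtracking random walk `(w 0, …, w m)` of length `m` with `w 0 = v`. -/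
noncomputable def nbWalk (v : V) : (m : ℕ) → PMF (Fin (m + 1) → V)
  | 0 => PMF.pure fun _ => v
  | m + 1 => (nbWalk v m).bind fun w =>
      (G.nbNext w).map fun x => Fin.snoc (α := fun _ => V) w x

end Walk

/-- The number of visits to `u` that the walk `(w 0, …, w m)` makes at the times `1, …, m`. -/
def visits {V : Type*} [DecidableEq V] {m : ℕ} (w : Fin (m + 1) → V) (u : V) : ℕ :=
  Finset.card {j : Fin m | w j.succ = u}

end SimpleGraph

/-! The joint characteristic function of the visit counts is the expectation of a product over time
of weights `1 + ζ`, where `ζ` equals `exp (i t_i) - 1` at the i-th marked vertex and vanishes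
elsewhere. With independent uniform steps this expectation would be a power of `1 + Z / n`, where `Z
= ∑ (exp (i t_i) - 1)`; with about `μ n` factors it tends to `exp (μ Z)`, the characteristic
function of independent Poisson variables. The task is to compare the actual walk with this model.

Expanding the product at the first factor where `ζ` is chosen gives a renewal equation that restarts
the walk only at marked vertices. Its solution is close to the power of `1 + Z / n` as soon as, from
such a restart, the visit probabilities to each marked vertex differ from `1 / n` by a total `ε`
that tends to 0 (`norm_nbGen_sub_le`).

Two facts give this. For the first `L` steps, girth and separation force the visit probability to be
0, which costs `L / n`. Later, the spectral bound gives exponential mixing uniformly in the graph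
(`exists_mixing`), which costs the tail of a convergent series. Letting `L` tend to infinity with `L
/ n → 0` makes both small. -/

/-! ### Spectral decay of the non-backtracking recurrence -/

/-- The roots of `z² = t z - q` lie in a disc of radius less than `1`, uniformly in `|t| ≤ τ < 1 + q`. -/
theorem exists_norm_root_le {q τ : ℝ} (hq0 : 0 < q) (hq : q ≤ 1 / 2) (hτ : τ < 1 + q) :
    ∃ ρ : ℝ, 3 / 4 ≤ ρ ∧ ρ < 1 ∧ ∀ t : ℝ, |t| ≤ τ → ∀ z : ℂ, z ^ 2 = t * z - q → ‖z‖ ≤ ρ := by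
  -- Non-real roots have `‖z‖² = q ≤ 1/2 < (3/4)²`. A real root has `‖z‖² + q ≤ τ ‖z‖`, which forces
  -- `1 - ‖z‖ ≥ (1 + q - τ) / 2`.
  refine ⟨max (3 / 4) (1 - (1 + q - τ) / 2), le_max_left _ _,
    max_lt (by norm_num) (by linarith), fun t ht z hz => ?_⟩
  by_contra! h
  obtain ⟨h1, h2⟩ := max_lt_iff.1 h
  have hre := congrArg Complex.re hz
  have him := congrArg Complex.im hz
  simp only [pow_two, Complex.mul_re, Complex.mul_im, Complex.sub_re, Complex.sub_im,
    Complex.ofReal_re, Complex.ofReal_im] at hre him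
  have hn : ‖z‖ ^ 2 = z.re ^ 2 + z.im ^ 2 := by
    rw [Complex.sq_norm, Complex.normSq_apply]; ring
  have hτ0 : 0 ≤ τ := (abs_nonneg t).trans ht
  by_cases hy : z.im = 0
  · have e1 : ‖z‖ ^ 2 + q = t * z.re := by rw [hn]; nlinarith
    have e2 : |z.re| ≤ ‖z‖ := Complex.abs_re_le_norm z
    have e3 : t * z.re ≤ τ * ‖z‖ := by
      calc t * z.re ≤ |t * z.re| := le_abs_self _
        _ = |t| * |z.re| := abs_mul _ _
        _ ≤ τ * ‖z‖ := by gcongr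
    nlinarith [sq_nonneg (1 - ‖z‖)]
  · have e1 : z.re * 2 = t := by
      have : z.im * (z.re * 2 - t) = 0 := by linarith
      rcases mul_eq_zero.1 this with h | h
      · exact absurd h hy
      · linarith
    have e2 : ‖z‖ ^ 2 = q := by rw [hn]; subst e1; nlinarith
    nlinarith

/-- With `α` and `t - α` the characteristic roots, `x (k + 1) - (t - α) x k` is geometric of ratio
`α`. Summing this first-order recurrence costs only a factor `k + 1`, so the bound remains uniform
when the roots coalesce. -/
theorem abs_le_of_linear_recurrence {q t ρ : ℝ} (hρ0 : 0 < ρ) (hρ1 : ρ ≤ 1)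
    (hroot : ∀ z : ℂ, z ^ 2 = t * z - q → ‖z‖ ≤ ρ) (x : ℕ → ℝ)
    (hx : ∀ k, x (k + 2) = t * x (k + 1) - q * x k) (k : ℕ) :
    ρ * |x k| ≤ (k + 1) * ρ ^ k * (|x 1| + |x 0|) := by
  obtain ⟨α, hα⟩ : ∃ z : ℂ, z ^ 2 = t * z - q := by
    obtain ⟨s, hs⟩ := IsAlgClosed.exists_pow_nat_eq ((t : ℂ) ^ 2 - 4 * q) (n := 2) (by norm_num)
    exact ⟨(t + s) / 2, by linear_combination hs / 4⟩
  have hβ : ((t : ℂ) - α) ^ 2 = t * (t - α) - q := by linear_combination hα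
  have hα' := hroot _ hα
  have hβ' := hroot _ hβ
  have hxc : ∀ k, (x (k + 2) : ℂ) = t * x (k + 1) - q * x k := fun k => by
    rw [hx]; push_cast; ring
  have hw : ∀ k, (x (k + 1) : ℂ) - (t - α) * x k = α ^ k * (x 1 - (t - α) * x 0) := by
    intro k
    induction k with
    | zero => simp
    | succ k ih =>
      rw [pow_succ, mul_right_comm, ← ih, hxc]
      linear_combination -(x k : ℂ) * hα
  have hM : ‖(x 1 : ℂ) - (t - α) * x 0‖ ≤ |x 1| + |x 0| := by
    refine (norm_sub_le _ _).trans ?_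
    rw [norm_mul, Complex.norm_real, Complex.norm_real, Real.norm_eq_abs, Real.norm_eq_abs]
    have := mul_le_mul_of_nonneg_right (hβ'.trans hρ1) (abs_nonneg (x 0))
    linarith
  have hstep : ∀ k, |x (k + 1)| ≤ ρ * |x k| + ρ ^ k * (|x 1| + |x 0|) := by
    intro k
    have e : (x (k + 1) : ℂ) = (t - α) * x k + α ^ k * (x 1 - (t - α) * x 0) := by
      rw [← hw]; ring
    rw [← Real.norm_eq_abs, ← Complex.norm_real, e]
    refine (norm_add_le _ _).trans ?_
    rw [norm_mul, norm_mul, norm_pow, Complex.norm_real, Real.norm_eq_abs]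
    gcongr
  induction k with
  | zero =>
    have := mul_le_mul_of_nonneg_right hρ1 (abs_nonneg (x 0))
    simp
    linarith [abs_nonneg (x 1)]
  | succ k ih =>
    have h1 := mul_le_mul_of_nonneg_left (hstep k) hρ0.le
    have h2 := mul_le_mul_of_nonneg_left ih hρ0.le
    calc ρ * |x (k + 1)| ≤ ρ * (ρ * |x k| + ρ ^ k * (|x 1| + |x 0|)) := h1
      _ = ρ * (ρ * |x k|) + ρ * (ρ ^ k * (|x 1| + |x 0|)) := by ring
      _ ≤ ρ * ((k + 1) * ρ ^ k * (|x 1| + |x 0|)) + ρ * (ρ ^ k * (|x 1| + |x 0|)) := by linarith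
      _ = _ := by push_cast; ring

namespace SimpleGraph

open Matrix

variable {V : Type*} [Fintype V] [DecidableEq V] {G : SimpleGraph V} [DecidableRel G.Adj]

/-- The constant vector has eigenvalue `d > lam`, so it is orthogonal to every eigenvector whose
eigenvalue is at most `lam`. The one remaining eigenvector must then be proportional to it, and so
annihilates mean-zero functions. -/
theorem IsNDLambdaGraph.exists_eigenbasis {n d : ℕ} {lam : ℝ} (hG : G.IsNDLambdaGraph n d lam)
    (hlam : lam < d) :
    ∃ (e : V → V → ℝ) (θ : V → ℝ), (∀ i x, e i ⬝ᵥ (G.adjMatrix ℝ *ᵥ x) = θ i * (e i ⬝ᵥ x)) ∧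
      (∀ x : V → ℝ, ∑ i, (e i ⬝ᵥ x) ^ 2 = ∑ u, x u ^ 2) ∧
      ∀ i, |θ i| ≤ lam ∨ ∀ x : V → ℝ, ∑ u, x u = 0 → e i ⬝ᵥ x = 0 := by
  set hA := G.isHermitian_adjMatrix ℝ
  set b := hA.eigenvectorBasis
  have hin : ∀ i (x : V → ℝ), inner ℝ (b i) (WithLp.toLp 2 x) = (b i : V → ℝ) ⬝ᵥ x := by
    intro i x
    simp [PiLp.inner_apply, dotProduct, mul_comm]
  have hadj : ∀ i (x : V → ℝ), (b i : V → ℝ) ⬝ᵥ (G.adjMatrix ℝ *ᵥ x)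
      = hA.eigenvalues i * ((b i : V → ℝ) ⬝ᵥ x) := by
    intro i x
    rw [dotProduct_mulVec, ← mulVec_transpose, transpose_adjMatrix, hA.mulVec_eigenvectorBasis,
      smul_dotProduct, smul_eq_mul]
  have hpars : ∀ x y : V → ℝ, ∑ i, ((b i : V → ℝ) ⬝ᵥ x) * ((b i : V → ℝ) ⬝ᵥ y) = x ⬝ᵥ y := by
    intro x y
    have := b.sum_inner_mul_inner (WithLp.toLp 2 x) (WithLp.toLp 2 y)
    rw [show inner ℝ (WithLp.toLp 2 x) (WithLp.toLp 2 y) = x ⬝ᵥ y by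
      simp [PiLp.inner_apply, dotProduct, mul_comm]] at this
    rw [← this]
    exact Finset.sum_congr rfl fun i _ => by rw [real_inner_comm (b i), hin, hin]
  refine ⟨fun i => b i, hA.eigenvalues, hadj, fun x => ?_, fun i => ?_⟩
  · have := hpars x x
    simpa [pow_two, dotProduct] using this
  have hbig : ∀ j, 0 < ((Fintype.equivOfCardEq (Fintype.card_fin _)).symm j :
      Fin (Fintype.card V)).val → |hA.eigenvalues j| ≤ lam :=
    fun j hj => hG.abs_eigenvalue_le _ hj
  rcases Nat.eq_zero_or_pos ((Fintype.equivOfCardEq (Fintype.card_fin _)).symm i :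
      Fin (Fintype.card V)).val with h0 | h0
  swap
  · exact Or.inl (hbig i h0)
  right
  intro x hx
  have hone : ∀ j, j ≠ i → (b j : V → ℝ) ⬝ᵥ (fun _ => (1 : ℝ)) = 0 := by
    intro j hj
    have hj' : |hA.eigenvalues j| ≤ lam := by
      apply hbig j
      rw [Nat.pos_iff_ne_zero]
      intro h
      apply hj
      apply (Fintype.equivOfCardEq (Fintype.card_fin (Fintype.card V))).symm.injective
      exact Fin.ext (h.trans h0.symm)
    have h1 := hadj j (fun _ => 1)
    have h2 : G.adjMatrix ℝ *ᵥ (fun _ => (1 : ℝ)) = (d : ℝ) • fun _ => (1 : ℝ) := by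
      ext u
      simp [adjMatrix_mulVec_apply, hG.regular.degree_eq u]
    rw [h2, dotProduct_smul, smul_eq_mul] at h1
    have h3 : hA.eigenvalues j < d := (le_abs_self _).trans_lt (hj'.trans_lt hlam)
    have h4 : ((d : ℝ) - hA.eigenvalues j) * ((b j : V → ℝ) ⬝ᵥ (fun _ => (1 : ℝ))) = 0 := by
      linarith
    rcases mul_eq_zero.1 h4 with h | h
    · linarith
    · exact h
  have hcross := hpars (fun _ => 1) x
  have hself := hpars (fun _ => 1) (fun _ => 1)
  -- Parseval for the pairs `(1, x)` and `(1, 1)` collapses to the term `i`: the product of the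
  -- coordinates of `1` and `x` is 0, while the square of that of `1` is `|V| ≠ 0`.
  rw [Finset.sum_eq_single i (fun j _ hj => by rw [hone j hj, zero_mul]) (by simp)] at hcross hself
  have hx' : (fun _ => (1 : ℝ)) ⬝ᵥ x = 0 := by simpa [dotProduct] using hx
  rw [hx'] at hcross
  rcases mul_eq_zero.1 hcross with h | h
  · exfalso
    rw [h] at hself
    have : Nonempty V := ⟨i⟩
    simp only [zero_mul, dotProduct, mul_one, Finset.sum_const, Finset.card_univ,
      nsmul_eq_mul] at hself
    exact Fintype.card_ne_zero (α := V) (by exact_mod_cast hself.symm)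
  · exact h

/-- Exponential decay, uniform over all `(n, d, lam)` graphs, of the solutions of the recurrence
satisfied by the numbers of non-backtracking walks. -/
theorem IsNDLambdaGraph.exists_decay {d : ℕ} (hd : 3 ≤ d) {lam : ℝ} (hlam : lam < d) :
    ∃ ρ : ℝ, 3 / 4 ≤ ρ ∧ ρ < 1 ∧ ∀ (V : Type*) [Fintype V] [DecidableEq V] (G : SimpleGraph V)
      [DecidableRel G.Adj] (n : ℕ), G.IsNDLambdaGraph n d lam → ∀ x : ℕ → V → ℝ,
      ∑ u, x 0 u = 0 → x 1 = ((d : ℝ) - 1)⁻¹ • (G.adjMatrix ℝ *ᵥ x 0) →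
      (∀ k, x (k + 2) = ((d : ℝ) - 1)⁻¹ • (G.adjMatrix ℝ *ᵥ x (k + 1) - x k)) →
      ∀ k u, ρ * |x k u| ≤ 3 * (k + 1) * ρ ^ k * √(∑ u, x 0 u ^ 2) := by
  have hd' : (3 : ℝ) ≤ d := by exact_mod_cast hd
  have hq0 : 0 < ((d : ℝ) - 1)⁻¹ := by rw [inv_pos]; linarith
  have hq : ((d : ℝ) - 1)⁻¹ ≤ 1 / 2 := by
    rw [one_div]; apply inv_anti₀ <;> linarith
  have hqd : ((d : ℝ) - 1)⁻¹ * (d - 1) = 1 := inv_mul_cancel₀ (by linarith)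
  -- The condition `τ < 1 + q` with `q = 1 / (d - 1)` and `τ = q * lam` is exactly `lam < d`.
  obtain ⟨ρ, h1, h2, h3⟩ := exists_norm_root_le (τ := ((d : ℝ) - 1)⁻¹ * lam) hq0 hq
    (by nlinarith)
  refine ⟨ρ, h1, h2, fun V _ _ G _ n hG x hx0 hx1 hx k u => ?_⟩
  obtain ⟨e, θ, hadj, hpars, hθ⟩ := hG.exists_eigenbasis hlam
  have hsum1 : ∀ i, (∀ y : V → ℝ, ∑ u, y u = 0 → e i ⬝ᵥ y = 0) → ∀ k, e i ⬝ᵥ x k = 0 := by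
    intro i hi k
    induction k using Nat.strong_induction_on with
    | _ k ih =>
      match k with
      | 0 => exact hi _ hx0
      | 1 => rw [hx1, dotProduct_smul, hadj, hi _ hx0]; simp
      | k + 2 => rw [hx, dotProduct_smul, dotProduct_sub, hadj, ih k (by omega),
          ih (k + 1) (by omega)]; simp
  have hcoord : ∀ i, (ρ * (e i ⬝ᵥ x k)) ^ 2 ≤ (3 * (k + 1) * ρ ^ k) ^ 2 * (e i ⬝ᵥ x 0) ^ 2 := by
    intro i
    rcases hθ i with hi | hi
    swap
    · rw [hsum1 i hi, hsum1 i hi]; simp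
    rw [← mul_pow, sq_le_sq, abs_mul, abs_of_pos (show 0 < ρ by linarith), abs_mul,
      abs_of_nonneg (show 0 ≤ 3 * (k + 1) * ρ ^ k by positivity)]
    have ht : |((d : ℝ) - 1)⁻¹ * θ i| ≤ ((d : ℝ) - 1)⁻¹ * lam := by
      rw [abs_mul, abs_of_pos hq0]; gcongr
    have hrec := abs_le_of_linear_recurrence (q := ((d : ℝ) - 1)⁻¹) (ρ := ρ) (by linarith) h2.le
      (h3 _ ht) (fun k => e i ⬝ᵥ x k) (fun k => by
        rw [hx, dotProduct_smul, dotProduct_sub, hadj]; simp; ring) k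
    refine hrec.trans ?_
    have h5 : |e i ⬝ᵥ x 1| ≤ 2 * |e i ⬝ᵥ x 0| := by
      rw [hx1, dotProduct_smul, hadj, smul_eq_mul, ← mul_assoc, abs_mul]
      gcongr
      refine ht.trans ?_
      nlinarith
    calc (k + 1) * ρ ^ k * (|e i ⬝ᵥ x 1| + |e i ⬝ᵥ x 0|)
        ≤ (k + 1) * ρ ^ k * (2 * |e i ⬝ᵥ x 0| + |e i ⬝ᵥ x 0|) := by gcongr
      _ = _ := by ring
  have hmain : (ρ * |x k u|) ^ 2 ≤ (3 * (k + 1) * ρ ^ k * √(∑ u, x 0 u ^ 2)) ^ 2 := by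
    calc (ρ * |x k u|) ^ 2 = ρ ^ 2 * x k u ^ 2 := by rw [mul_pow, sq_abs]
      _ ≤ ρ ^ 2 * ∑ u, x k u ^ 2 := by
        gcongr
        exact Finset.single_le_sum (f := fun u => x k u ^ 2) (fun _ _ => sq_nonneg _)
          (Finset.mem_univ u)
      _ = ∑ i, (ρ * (e i ⬝ᵥ x k)) ^ 2 := by simp_rw [mul_pow]; rw [← hpars, Finset.mul_sum]
      _ ≤ ∑ i, (3 * (k + 1) * ρ ^ k) ^ 2 * (e i ⬝ᵥ x 0) ^ 2 := Finset.sum_le_sum fun i _ => hcoord i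
      _ = _ := by
        rw [← Finset.mul_sum, hpars, mul_pow _ (√_), Real.sq_sqrt (Finset.sum_nonneg fun _ _ => sq_nonneg _)]
  have : 0 < ρ := by linarith
  exact (pow_le_pow_iff_left₀ (by positivity) (by positivity) two_ne_zero).1 hmain

end SimpleGraph

/-! ### The non-backtracking operator: mixing and short times -/

namespace SimpleGraph

section NbOp

open Matrix

variable {V : Type*} [Fintype V] [DecidableEq V] (G : SimpleGraph V) [DecidableRel G.Adj]
  {E : Type*} [NormedAddCommGroup E] [NormedSpace ℝ E]

/-- The transition operator of the non-backtracking random walk on a `d`-regular graph. The states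
are the pairs `(a, b)` consisting of the previous and of the current vertex. -/
noncomputable def nbOp (d : ℕ) (E : Type*) [NormedAddCommGroup E] [NormedSpace ℝ E] :
    (V → V → E) →ₗ[ℝ] V → V → E where
  toFun f a b := ((d : ℝ) - 1)⁻¹ • ∑ c ∈ (G.neighborFinset b).erase a, f b c
  map_add' f g := by ext a b; simp [Finset.sum_add_distrib]
  map_smul' t f := by ext a b; simp [Finset.smul_sum, smul_comm t]

/-- The indicator of the pairs with second component `u`. -/
def headInd (u : V) : V → V → ℝ := fun _ b => if b = u then 1 else 0

variable {G} {d : ℕ}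

theorem nbOp_apply (f : V → V → E) (a b : V) :
    G.nbOp d E f a b = ((d : ℝ) - 1)⁻¹ • ∑ c ∈ (G.neighborFinset b).erase a, f b c := rfl

theorem nbOp_congr {f g : V → V → E} (h : ∀ a b, G.Adj a b → f a b = g a b) :
    G.nbOp d E f = G.nbOp d E g := by
  ext a b
  rw [nbOp_apply, nbOp_apply]
  congr 1
  refine Finset.sum_congr rfl fun c hc => h _ _ ?_
  simpa using Finset.mem_of_mem_erase hc

/-- The factor `1 / (d - 1)` is the right normalisation only when `a` is a neighbour of `b`; this is
why the estimates are confined to adjacent pairs. -/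
theorem nbOp_const (hG : G.IsRegularOfDegree d) (hd : 2 ≤ d) (c : E) {a b : V} (hab : G.Adj a b) :
    G.nbOp d E (fun _ _ => c) a b = c := by
  have hd' : (2 : ℝ) ≤ d := by exact_mod_cast hd
  rw [nbOp_apply, Finset.sum_const, Finset.card_erase_of_mem (by simpa using hab.symm),
    card_neighborFinset_eq_degree, hG.degree_eq, ← Nat.cast_smul_eq_nsmul ℝ, smul_smul,
    Nat.cast_sub (by omega), Nat.cast_one, inv_mul_cancel₀ (by linarith), one_smul]

theorem nbOp_pow_smul_const (h : V → V → ℝ) (c : E) (j : ℕ) (a b : V) :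
    (G.nbOp d E ^ j) (fun a b => h a b • c) a b = (G.nbOp d ℝ ^ j) h a b • c := by
  induction j generalizing a b with
  | zero => simp
  | succ j ih =>
    rw [pow_succ', pow_succ', Module.End.mul_apply, Module.End.mul_apply, nbOp_apply, nbOp_apply]
    simp_rw [ih, ← Finset.sum_smul, smul_assoc]

theorem norm_nbOp_pow_le (hd : 1 ≤ d) (f : V → V → E) (j : ℕ) (a b : V) :
    ‖(G.nbOp d E ^ j) f a b‖ ≤ (G.nbOp d ℝ ^ j) (fun a b => ‖f a b‖) a b := by
  have hd' : (1 : ℝ) ≤ d := by exact_mod_cast hd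
  induction j generalizing a b with
  | zero => simp
  | succ j ih =>
    rw [pow_succ', pow_succ', Module.End.mul_apply, Module.End.mul_apply, nbOp_apply, nbOp_apply,
      norm_smul, Real.norm_of_nonneg (inv_nonneg.2 (by linarith)), smul_eq_mul]
    refine mul_le_mul_of_nonneg_left ?_ (inv_nonneg.2 (by linarith))
    exact (norm_sum_le _ _).trans (Finset.sum_le_sum fun c _ => ih _ _)

theorem nbOp_pow_mono (hd : 1 ≤ d) {f g : V → V → ℝ} (h : ∀ a b, G.Adj a b → f a b ≤ g a b)
    (j : ℕ) {a b : V} (hab : G.Adj a b) : (G.nbOp d ℝ ^ j) f a b ≤ (G.nbOp d ℝ ^ j) g a b := by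
  have hd' : (1 : ℝ) ≤ d := by exact_mod_cast hd
  induction j generalizing a b with
  | zero => simpa using h a b hab
  | succ j ih =>
    rw [pow_succ', Module.End.mul_apply, Module.End.mul_apply, nbOp_apply, nbOp_apply]
    refine smul_le_smul_of_nonneg_left ?_ (inv_nonneg.2 (by linarith))
    refine Finset.sum_le_sum fun c hc => ih ?_
    simpa using Finset.mem_of_mem_erase hc

/-- Functions of the form `x b + y a` are preserved on adjacent pairs: erasing `a` from the
neighbour sum turns head dependence into tail dependence. This reduces the dynamics on pairs to the
adjacency matrix. -/
theorem nbOp_head_add_tail (hG : G.IsRegularOfDegree d) (hd : 2 ≤ d) (x y : V → ℝ) {a b : V}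
    (hab : G.Adj a b) :
    G.nbOp d ℝ (fun a b => x b + y a) a b
      = ((d : ℝ) - 1)⁻¹ * ((G.adjMatrix ℝ *ᵥ x) b - x a) + y b := by
  have e : (fun a b => x b + y a) = (fun _ b => x b) + fun a _ => y a := rfl
  rw [e, map_add, Pi.add_apply, Pi.add_apply]
  congr 1
  · rw [nbOp_apply, smul_eq_mul, adjMatrix_mulVec_apply,
      ← Finset.sum_erase_add _ _ (show a ∈ G.neighborFinset b by simpa using hab.symm)]
    ring
  · exact nbOp_const hG hd (y b) hab

/-- Mixing of the non-backtracking walk, uniform over all `(n, d, lam)` graphs. -/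
theorem IsNDLambdaGraph.exists_mixing {d : ℕ} (hd : 3 ≤ d) {lam : ℝ} (hlam : lam < d) :
    ∃ C ρ : ℝ, 0 ≤ C ∧ 0 < ρ ∧ ρ < 1 ∧ ∀ (V : Type*) [Fintype V] [DecidableEq V]
      (G : SimpleGraph V) [DecidableRel G.Adj] (n : ℕ), G.IsNDLambdaGraph n d lam →
      ∀ (u a b : V), G.Adj a b → ∀ j : ℕ,
      |(G.nbOp d ℝ ^ j) (headInd u) a b - (n : ℝ)⁻¹| ≤ C * ((j + 1) * ρ ^ j) := by
  obtain ⟨ρ, h1, h2, h3⟩ := IsNDLambdaGraph.exists_decay hd hlam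
  have hd' : (3 : ℝ) ≤ d := by exact_mod_cast hd
  have hρ : 0 < ρ := by linarith
  refine ⟨9, ρ, by norm_num, hρ, h2, fun V _ _ G _ n hG u a b hab j => ?_⟩
  have hq0 : 0 < ((d : ℝ) - 1)⁻¹ := by rw [inv_pos]; linarith
  have hq : ((d : ℝ) - 1)⁻¹ ≤ 1 / 2 := by
    rw [one_div]; apply inv_anti₀ <;> linarith
  have hn : 0 < n := by rw [← hG.card_eq]; exact Fintype.card_pos_iff.2 ⟨u⟩
  have hn' : (0 : ℝ) < n := by exact_mod_cast hn
  set x₀ : V → ℝ := fun c => (if c = u then 1 else 0) - (n : ℝ)⁻¹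
  -- One step of the operator on the head and tail parts of the centred indicator. Eliminating the
  -- tail part leaves the second-order recurrence of `exists_decay`.
  let S : (V → ℝ) × (V → ℝ) → (V → ℝ) × (V → ℝ) := fun p =>
    (((d : ℝ) - 1)⁻¹ • (G.adjMatrix ℝ *ᵥ p.1) + p.2, -(((d : ℝ) - 1)⁻¹ • p.1))
  let s : ℕ → (V → ℝ) × (V → ℝ) := fun k => S^[k] (x₀, 0)
  have hs : ∀ k, s (k + 1) = S (s k) := fun k => Function.iterate_succ_apply' _ _ _
  have hs1 : ∀ k, (s (k + 1)).1 = ((d : ℝ) - 1)⁻¹ • (G.adjMatrix ℝ *ᵥ (s k).1) + (s k).2 :=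
    fun k => by rw [hs]
  have hs2 : ∀ k, (s (k + 1)).2 = -(((d : ℝ) - 1)⁻¹ • (s k).1) := fun k => by rw [hs]
  have hrep : ∀ k a b, G.Adj a b →
      (G.nbOp d ℝ ^ k) (headInd u) a b = ((s k).1 b + (s k).2 a) + (n : ℝ)⁻¹ := by
    intro k
    induction k with
    | zero => intro a b _; simp [s, x₀, headInd]
    | succ k ih =>
      intro a b hab
      rw [pow_succ', Module.End.mul_apply, nbOp_congr ih]
      have e : (fun a b => ((s k).1 b + (s k).2 a) + (n : ℝ)⁻¹)
        = (fun a b => (s k).1 b + (s k).2 a) + fun _ _ => (n : ℝ)⁻¹ := rfl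
      rw [e, map_add, Pi.add_apply, Pi.add_apply, nbOp_const hG.regular (by omega) _ hab,
        nbOp_head_add_tail hG.regular (by omega) _ _ hab, hs1, hs2]
      simp
      ring
  have hsum0 : ∑ c, x₀ c = 0 := by
    simp [x₀, Finset.sum_sub_distrib, hG.card_eq, hn'.ne']
  have hsq : √(∑ c, x₀ c ^ 2) ≤ 1 := by
    refine Real.sqrt_le_iff.2 ⟨zero_le_one, ?_⟩
    rw [one_pow]
    have e : ∀ c, x₀ c ^ 2 = (1 - (n : ℝ)⁻¹) * (if c = u then 1 else 0) - (n : ℝ)⁻¹ * x₀ c := by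
      intro c; simp only [x₀]; split_ifs <;> ring
    simp_rw [e, Finset.sum_sub_distrib, ← Finset.mul_sum, hsum0]
    simp
  have hdec : ∀ k c, ρ * |(s k).1 c| ≤ 3 * (k + 1) * ρ ^ k := by
    intro k c
    have := h3 V G n hG (fun k => (s k).1) hsum0 ((hs1 0).trans (add_zero _))
      (fun k => by rw [hs1, hs2, smul_sub]; exact (sub_eq_add_neg _ _).symm) k c
    refine this.trans ?_
    exact mul_le_of_le_one_right (by positivity) hsq
  have hx : |(s j).1 b| ≤ 4 * ((j + 1) * ρ ^ j) := by
    have := hdec j b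
    have h0 : 0 ≤ |(s j).1 b| := abs_nonneg _
    nlinarith
  have hy : |(s j).2 a| ≤ 3 * ((j + 1) * ρ ^ j) := by
    rcases j with _ | j
    · simp [s]
    · rw [hs2, Pi.neg_apply, abs_neg, Pi.smul_apply, smul_eq_mul, abs_mul, abs_of_pos hq0]
      have h4 := hdec j a
      have h0 : 0 ≤ |(s j).1 a| := abs_nonneg _
      -- The tail part lags one step behind the head part; `ρ ≥ 3/4` pays for the lag and for the
      -- factor `ρ` on the left of `hdec`.
      have h5 : ρ ^ j * (9 / 16) ≤ ρ ^ (j + 1) * ρ := by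
        rw [pow_succ, mul_assoc]; gcongr; nlinarith
      have h6 : ρ * (((d : ℝ) - 1)⁻¹ * |(s j).1 a|) ≤ ρ * (3 * ((↑(j + 1) + 1) * ρ ^ (j + 1))) := by
        have hp : 0 < ρ ^ j := by positivity
        have hj : (0 : ℝ) ≤ j := by positivity
        calc ρ * (((d : ℝ) - 1)⁻¹ * |(s j).1 a|) = ((d : ℝ) - 1)⁻¹ * (ρ * |(s j).1 a|) := by ring
          _ ≤ 1 / 2 * (3 * (j + 1) * ρ ^ j) := by gcongr
          _ ≤ 3 * (j + 2) * (ρ ^ j * (9 / 16)) := by nlinarith [mul_nonneg hj hp.le]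
          _ ≤ 3 * (j + 2) * (ρ ^ (j + 1) * ρ) := by gcongr
          _ = _ := by push_cast; ring
      exact le_of_mul_le_mul_left h6 hρ
  rw [hrep j a b hab, add_sub_cancel_right]
  refine (abs_add_le _ _).trans ?_
  have : 0 ≤ (j + 1) * ρ ^ j := by positivity
  linarith

/-- A nonzero entry is witnessed by a non-backtracking walk, and a non-backtracking walk shorter
than the girth cannot meet itself: its return would close a short cycle. -/
theorem exists_isPath_of_nbOp_pow_ne_zero (u : V) (j : ℕ) :
    ∀ {a b : V} (hab : G.Adj a b), ((j + 1 : ℕ) : ℕ∞) < G.egirth →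
      (G.nbOp d ℝ ^ j) (headInd u) a b ≠ 0 →
      ∃ p : G.Walk b u, p.length = j ∧ (Walk.cons hab p).IsPath := by
  induction j with
  | zero =>
    intro a b hab _ h
    have hb : b = u := by
      by_contra hne
      simp [headInd, hne] at h
    subst hb
    exact ⟨Walk.nil, rfl, by simp [hab.ne]⟩
  | succ j ih =>
    intro a b hab hg h
    rw [pow_succ', Module.End.mul_apply, nbOp_apply] at h
    obtain ⟨c, hc, hcne⟩ := Finset.exists_ne_zero_of_sum_ne_zero (right_ne_zero_of_smul h)
    rw [Finset.mem_erase, mem_neighborFinset] at hc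
    obtain ⟨p, hp, hpath⟩ := ih hc.2 (lt_of_le_of_lt (by exact_mod_cast Nat.le_succ _) hg) hcne
    refine ⟨Walk.cons hc.2 p, by simp [hp], ?_⟩
    rw [Walk.cons_isPath_iff]
    refine ⟨hpath, fun hmem => ?_⟩
    set q := Walk.cons hc.2 p with hq
    -- The edge `ab` is not reused: the next vertex `c` differs from `a`, and the path does not
    -- return to `b`.
    have hcyc : (Walk.cons hab (q.takeUntil a hmem)).IsCycle := by
      rw [Walk.cons_isCycle_iff]
      refine ⟨hpath.takeUntil hmem, fun he => ?_⟩
      have he' : s(a, b) ∈ q.edges := q.edges_takeUntil_subset_edges hmem he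
      rw [hq, Walk.edges_cons, List.mem_cons] at he'
      rcases he' with he' | he'
      · rw [Sym2.eq_swap, Sym2.congr_right] at he'
        exact hc.1 he'.symm
      · rw [hq, Walk.cons_isPath_iff] at hpath
        exact hpath.2 (p.snd_mem_support_of_mem_edges he')
    have h1 := egirth_le_length hcyc
    have h2 := q.length_takeUntil_le_length hmem
    have h3 : (Walk.cons hab (q.takeUntil a hmem)).length ≤ j + 1 + 1 := by
      rw [Walk.length_cons]
      have : q.length = j + 1 := by simp [hq, hp]
      omega
    exact absurd (hg.trans_le h1) (not_lt.2 (by exact_mod_cast h3))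

end NbOp

end SimpleGraph

/-! ### The renewal equation and comparison with independent steps -/

namespace SimpleGraph

section NbGen

variable {V : Type*} [Fintype V] [DecidableEq V] (G : SimpleGraph V) [DecidableRel G.Adj]

/-- `G.nbGen d W m a b` is the expectation of the product of the weights `W` of the next `m`
vertices of the non-backtracking walk whose last two vertices are `a` and `b`. -/
noncomputable def nbGen (d : ℕ) (W : V → ℂ) : ℕ → V → V → ℂ
  | 0 => fun _ _ => 1
  | m + 1 => G.nbOp d ℂ fun a b => W b * nbGen d W m a b

variable {G} {d : ℕ}

/-- This is the expansion `∏ (1 + ζ_j) = 1 + ∑_j ζ_j ∏_{l > j} (1 + ζ_l)` in expectation. Index `j`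
stands for time `j + 1`, after which `m - 1 - j` steps remain. -/
theorem nbGen_eq_one_add_sum (hG : G.IsRegularOfDegree d) (hd : 2 ≤ d) (ζ : V → ℂ) (m : ℕ) :
    ∀ {a b : V}, G.Adj a b → G.nbGen d (fun x => 1 + ζ x) m a b = 1 + ∑ j ∈ Finset.range m,
      (G.nbOp d ℂ ^ (j + 1)) (fun a b => ζ b * G.nbGen d (fun x => 1 + ζ x) (m - 1 - j) a b) a b := by
  induction m with
  | zero => intro a b _; simp [nbGen]
  | succ m ih =>
    intro a b hab
    have e : (fun a b => (1 + ζ b) * G.nbGen d (fun x => 1 + ζ x) m a b)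
      = (fun a b => G.nbGen d (fun x => 1 + ζ x) m a b)
        + fun a b => ζ b * G.nbGen d (fun x => 1 + ζ x) m a b := by
      ext a b; simp [add_mul]
    rw [nbGen, e, map_add, Pi.add_apply, Pi.add_apply, nbOp_congr fun a b h => ih h,
      Finset.sum_range_succ']
    have e2 : (fun a b => 1 + ∑ j ∈ Finset.range m, (G.nbOp d ℂ ^ (j + 1))
        (fun a b => ζ b * G.nbGen d (fun x => 1 + ζ x) (m - 1 - j) a b) a b)
      = (fun _ _ => (1 : ℂ)) + ∑ j ∈ Finset.range m, (G.nbOp d ℂ ^ (j + 1))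
        (fun a b => ζ b * G.nbGen d (fun x => 1 + ζ x) (m - 1 - j) a b) := by
      ext a b; simp [Finset.sum_apply]
    rw [e2, map_add, map_sum, Pi.add_apply, Pi.add_apply, nbOp_const hG hd _ hab,
      Finset.sum_apply, Finset.sum_apply, add_assoc]
    congr 2
    refine Finset.sum_congr rfl fun j _ => ?_
    rw [pow_succ' _ (j + 1), Module.End.mul_apply, show m + 1 - 1 - (j + 1) = m - 1 - j by omega]

/-- If, from suitable pairs, the visit probabilities of the non-backtracking walk to the vertices
`v i` are summably close to `1 / n`, then the weighted expectations are close to those of a walk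
whose steps are independent and uniform. -/
theorem norm_nbGen_sub_le (hG : G.IsRegularOfDegree d) (hd : 2 ≤ d) {ι : Type*} [Fintype ι]
    (v : ι → V) (z : ι → ℂ) {n K ε : ℝ} (hn : 0 < n) (hK : 0 < K) (hz : ∑ i, ‖z i‖ ≤ K)
    (hε : 0 ≤ ε) (hKε : K * ε ≤ 1 / 4) (P : V → V → Prop)
    (hP : ∀ a b, G.Adj a b → P a b → ∀ i m,
      ∑ j ∈ Finset.range m, |(G.nbOp d ℝ ^ (j + 1)) (headInd (v i)) a b - n⁻¹| ≤ ε)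
    (hv : ∀ a i, G.Adj a (v i) → P a (v i)) (m : ℕ) :
    ∀ a b, G.Adj a b → P a b →
      ‖G.nbGen d (fun x => 1 + ∑ i, if x = v i then z i else 0) m a b
        - (1 + (∑ i, z i) / n) ^ m‖ ≤ 4 * (K * ε) * (1 + 2 * K / n) ^ m := by
  induction m using Nat.strong_induction_on with
  | _ m ih =>
  intro a b hab hPab
  set ζ : V → ℂ := fun x => ∑ i, if x = v i then z i else 0 with hζ
  set c : ℂ := 1 + (∑ i, z i) / n with hc
  -- The 2 makes the propagated error `(K * B / n) / β` equal to `B / 2`; the direct error `(1 + B)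
  -- * (K * ε)` is also at most `B / 2`, since `B = 4 * (K * ε) ≤ 1`.
  set β : ℝ := 2 * K / n with hβ
  have hβ0 : 0 < β := by positivity
  set p : ℕ → ι → ℝ := fun j i => (G.nbOp d ℝ ^ (j + 1)) (headInd (v i)) a b with hp
  set φ := G.nbGen d (fun x => 1 + ζ x) with hφ
  have hcn : ‖c‖ ≤ 1 + β := by
    refine (norm_add_le _ _).trans ?_
    rw [norm_one, norm_div, Complex.norm_real, Real.norm_of_nonneg hn.le, hβ]
    have : ‖∑ i, z i‖ ≤ 2 * K := (norm_sum_le _ _).trans (by linarith)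
    gcongr
  have hζh : ∀ a b, ζ b = ∑ i, headInd (v i) a b • z i := by
    intro a b
    simp only [ζ, headInd, ite_smul, one_smul, zero_smul]
  -- Two errors: the visit probability against `1 / n`, with the ideal continuation `c ^ l`; and the
  -- continuation against `c ^ l`, with the true visit probability.
  have hsplit : ∀ j l, (G.nbOp d ℂ ^ (j + 1)) (fun a b => ζ b * φ l a b) a b
      - (∑ i, z i) / n * c ^ l
      = ∑ i, (((p j i - n⁻¹ : ℝ) : ℂ) * z i) * c ^ l
        + (G.nbOp d ℂ ^ (j + 1)) (fun a b => ζ b * (φ l a b - c ^ l)) a b := by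
    intro j l
    have e1 : (fun a b => ζ b * φ l a b) = (∑ i, fun a b => headInd (v i) a b • (z i * c ^ l))
        + fun a b => ζ b * (φ l a b - c ^ l) := by
      ext a b
      simp only [Pi.add_apply, Finset.sum_apply]
      simp_rw [← smul_mul_assoc, ← Finset.sum_mul, ← hζh]
      ring
    rw [e1, map_add, map_sum, Pi.add_apply, Pi.add_apply, Finset.sum_apply, Finset.sum_apply]
    simp_rw [nbOp_pow_smul_const]
    rw [add_sub_right_comm]
    congr 1
    rw [Finset.sum_div, Finset.sum_mul, ← Finset.sum_sub_distrib]
    refine Finset.sum_congr rfl fun i _ => ?_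
    rw [Complex.real_smul]
    push_cast
    ring
  -- The ideal power solves the same renewal equation with every visit probability equal to `1 / n`.
  have hgeom : c ^ m = 1 + ∑ j ∈ Finset.range m, (∑ i, z i) / n * c ^ (m - 1 - j) := by
    rw [← Finset.mul_sum, Finset.sum_range_reflect (fun l => c ^ l) m]
    have := mul_geom_sum c m
    rw [show c - 1 = (∑ i, z i) / n by rw [hc]; ring] at this
    rw [this]; ring
  have hD : φ m a b - c ^ m = ∑ j ∈ Finset.range m,
      (∑ i, (((p j i - n⁻¹ : ℝ) : ℂ) * z i) * c ^ (m - 1 - j)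
        + (G.nbOp d ℂ ^ (j + 1)) (fun a b => ζ b * (φ (m - 1 - j) a b - c ^ (m - 1 - j))) a b) := by
    rw [hφ, nbGen_eq_one_add_sum hG hd ζ m hab, hgeom, add_sub_add_left_eq_sub,
      ← Finset.sum_sub_distrib]
    exact Finset.sum_congr rfl fun j _ => hsplit j _
  set B : ℝ := 4 * (K * ε) with hB
  have hB0 : 0 ≤ B := by positivity
  have hone : (1 : ℝ) ≤ 1 + β := by linarith
  have hterm2 : ∀ j < m, ‖(G.nbOp d ℂ ^ (j + 1))
      (fun a b => ζ b * (φ (m - 1 - j) a b - c ^ (m - 1 - j))) a b‖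
      ≤ ∑ i, p j i * (‖z i‖ * (B * (1 + β) ^ (m - 1 - j))) := by
    intro j hj
    set l := m - 1 - j with hl
    refine (norm_nbOp_pow_le (by omega) _ _ _ _).trans ?_
    have hle : ∀ a b, G.Adj a b → ‖ζ b * (φ l a b - c ^ l)‖
        ≤ (∑ i, fun a b => headInd (v i) a b • (‖z i‖ * (B * (1 + β) ^ l)) : V → V → ℝ) a b := by
      intro a b hab
      simp only [Finset.sum_apply, smul_eq_mul]
      rw [norm_mul, hζh a b]
      refine (mul_le_mul_of_nonneg_right (norm_sum_le _ _) (norm_nonneg _)).trans ?_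
      rw [Finset.sum_mul]
      refine Finset.sum_le_sum fun i _ => ?_
      by_cases hb : b = v i
      · subst hb
        simp only [headInd, if_true, one_smul, one_mul]
        gcongr
        -- Since `ζ` is supported on marked vertices, the induction hypothesis is needed only at
        -- pairs ending there, which satisfy `P` by `hv`.
        exact ih l (by omega) a (v i) hab (hv a i hab)
      · simp [headInd, hb]
    refine (nbOp_pow_mono (by omega) hle (j + 1) hab).trans_eq ?_
    rw [map_sum, Finset.sum_apply, Finset.sum_apply]
    simp_rw [nbOp_pow_smul_const, smul_eq_mul]
    rfl
  have hsumE : ∑ j ∈ Finset.range m, ∑ i, |p j i - n⁻¹| * ‖z i‖ ≤ K * ε := by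
    rw [Finset.sum_comm]
    calc ∑ i, ∑ j ∈ Finset.range m, |p j i - n⁻¹| * ‖z i‖ ≤ ∑ i, ε * ‖z i‖ := by
          refine Finset.sum_le_sum fun i _ => ?_
          rw [← Finset.sum_mul]
          gcongr
          exact hP a b hab hPab i m
      _ ≤ K * ε := by rw [← Finset.mul_sum, mul_comm]; gcongr
  have hterm : ∀ j ∈ Finset.range m, ‖∑ i, (((p j i - n⁻¹ : ℝ) : ℂ) * z i) * c ^ (m - 1 - j)
        + (G.nbOp d ℂ ^ (j + 1)) (fun a b => ζ b * (φ (m - 1 - j) a b - c ^ (m - 1 - j))) a b‖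
      ≤ (1 + B) * (1 + β) ^ m * (∑ i, |p j i - n⁻¹| * ‖z i‖)
        + K * B / n * (1 + β) ^ (m - 1 - j) := by
    intro j hj
    rw [Finset.mem_range] at hj
    set l := m - 1 - j with hl
    have hpow : (1 + β) ^ l ≤ (1 + β) ^ m := pow_le_pow_right₀ hone (by omega)
    have t1 : ‖∑ i, (((p j i - n⁻¹ : ℝ) : ℂ) * z i) * c ^ l‖
        ≤ (1 + β) ^ m * ∑ i, |p j i - n⁻¹| * ‖z i‖ := by
      refine (norm_sum_le _ _).trans ?_
      rw [Finset.mul_sum]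
      refine Finset.sum_le_sum fun i _ => ?_
      rw [norm_mul, norm_mul, Complex.norm_real, Real.norm_eq_abs, norm_pow, mul_comm]
      gcongr
      exact (pow_le_pow_left₀ (norm_nonneg _) hcn l).trans hpow
    have t2 : ∑ i, p j i * (‖z i‖ * (B * (1 + β) ^ l))
        ≤ B * (1 + β) ^ m * (∑ i, |p j i - n⁻¹| * ‖z i‖) + K * B / n * (1 + β) ^ l := by
      calc ∑ i, p j i * (‖z i‖ * (B * (1 + β) ^ l))
          ≤ ∑ i, (|p j i - n⁻¹| * ‖z i‖ * (B * (1 + β) ^ m)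
              + ‖z i‖ * (n⁻¹ * B * (1 + β) ^ l)) := by
            refine Finset.sum_le_sum fun i _ => ?_
            have h1 : p j i ≤ |p j i - n⁻¹| + n⁻¹ := by linarith [le_abs_self (p j i - n⁻¹)]
            calc p j i * (‖z i‖ * (B * (1 + β) ^ l))
                ≤ (|p j i - n⁻¹| + n⁻¹) * (‖z i‖ * (B * (1 + β) ^ l)) := by gcongr
              _ = |p j i - n⁻¹| * ‖z i‖ * (B * (1 + β) ^ l) + ‖z i‖ * (n⁻¹ * B * (1 + β) ^ l) := by
                ring
              _ ≤ _ := by gcongr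
        _ = B * (1 + β) ^ m * (∑ i, |p j i - n⁻¹| * ‖z i‖)
              + (∑ i, ‖z i‖) * (n⁻¹ * B * (1 + β) ^ l) := by
            rw [Finset.sum_add_distrib, ← Finset.sum_mul, ← Finset.sum_mul]; ring
        _ ≤ B * (1 + β) ^ m * (∑ i, |p j i - n⁻¹| * ‖z i‖)
              + K * (n⁻¹ * B * (1 + β) ^ l) := by gcongr
        _ = _ := by ring
    refine (norm_add_le _ _).trans ((add_le_add t1 ((hterm2 j hj).trans t2)).trans_eq ?_)
    ring
  have hgs : ∑ j ∈ Finset.range m, (1 + β) ^ (m - 1 - j) ≤ (1 + β) ^ m / β := by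
    rw [Finset.sum_range_reflect (fun l => (1 + β) ^ l) m, le_div_iff₀ hβ0]
    have := mul_geom_sum (1 + β) m
    rw [add_sub_cancel_left] at this
    linarith
  rw [hD]
  calc ‖∑ j ∈ Finset.range m, _‖ ≤ ∑ j ∈ Finset.range m,
        ((1 + B) * (1 + β) ^ m * (∑ i, |p j i - n⁻¹| * ‖z i‖)
          + K * B / n * (1 + β) ^ (m - 1 - j)) := (norm_sum_le _ _).trans (Finset.sum_le_sum hterm)
    _ = (1 + B) * (1 + β) ^ m * (∑ j ∈ Finset.range m, ∑ i, |p j i - n⁻¹| * ‖z i‖)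
          + K * B / n * ∑ j ∈ Finset.range m, (1 + β) ^ (m - 1 - j) := by
        rw [Finset.sum_add_distrib, ← Finset.mul_sum, ← Finset.mul_sum]
    _ ≤ (1 + B) * (1 + β) ^ m * (K * ε) + K * B / n * ((1 + β) ^ m / β) := by gcongr
    _ = ((1 + B) * (K * ε) + B / 2) * (1 + β) ^ m := by rw [hβ]; field_simp
    _ ≤ B * (1 + β) ^ m := by
        gcongr
        nlinarith

end NbGen

end SimpleGraph

/-! ### From the law of the walk to the operator -/

section FiniteExpectation

variable {α β : Type*} [Fintype α] [Fintype β]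

theorem PMF.sum_toReal_bind (p : PMF α) (f : α → PMF β) (F : β → ℂ) :
    ∑ b, ((p.bind f b).toReal : ℂ) * F b
      = ∑ a, ((p a).toReal : ℂ) * ∑ b, ((f a b).toReal : ℂ) * F b := by
  simp_rw [PMF.bind_apply, tsum_fintype, Finset.mul_sum]
  rw [Finset.sum_comm]
  refine Finset.sum_congr rfl fun b _ => ?_
  rw [ENNReal.toReal_sum fun a _ => ENNReal.mul_ne_top (p.apply_ne_top a) ((f a).apply_ne_top b)]
  simp_rw [ENNReal.toReal_mul]
  push_cast
  rw [Finset.sum_mul]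
  exact Finset.sum_congr rfl fun a _ => mul_assoc _ _ _

theorem PMF.sum_toReal_pure [DecidableEq α] (a : α) (F : α → ℂ) :
    ∑ b, ((PMF.pure a b).toReal : ℂ) * F b = F a := by
  rw [Finset.sum_eq_single a]
  · simp
  · intro b _ hb; simp [PMF.pure_apply, hb]
  · simp

theorem PMF.sum_toReal_map [DecidableEq β] (p : PMF α) (f : α → β) (F : β → ℂ) :
    ∑ b, ((p.map f b).toReal : ℂ) * F b = ∑ a, ((p a).toReal : ℂ) * F (f a) := by
  rw [PMF.map, PMF.sum_toReal_bind]
  simp_rw [Function.comp_apply, PMF.sum_toReal_pure]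

theorem PMF.sum_toReal_uniformOfFinset [DecidableEq α] (s : Finset α) (hs : s.Nonempty)
    (F : α → ℂ) :
    ∑ a, ((PMF.uniformOfFinset s hs a).toReal : ℂ) * F a = (s.card : ℂ)⁻¹ * ∑ a ∈ s, F a := by
  rw [Finset.mul_sum, ← Finset.sum_subset (Finset.subset_univ s)]
  · refine Finset.sum_congr rfl fun a ha => ?_
    rw [PMF.uniformOfFinset_apply_of_mem hs ha]
    simp
  · intro a _ ha
    rw [PMF.uniformOfFinset_apply_of_notMem hs ha]
    simp

end FiniteExpectation

namespace SimpleGraph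

section WalkLaw

variable {V : Type*} [Fintype V] [DecidableEq V] {G : SimpleGraph V} [DecidableRel G.Adj] {d : ℕ}

theorem nbChoices_zero (w : Fin 1 → V) : G.nbChoices w = G.neighborFinset (w 0) := by
  ext x
  simp [nbChoices]

theorem nbChoices_succ {k : ℕ} (w : Fin (k + 1 + 1) → V) :
    G.nbChoices w
      = (G.neighborFinset (w (Fin.last (k + 1)))).erase (w (Fin.last k).castSucc) := by
  ext x
  simp only [nbChoices, Finset.mem_filter, Finset.mem_erase, and_comm (a := x ≠ _)]
  refine and_congr_right fun _ => ⟨fun h => h _ (by simp), fun h j hj => ?_⟩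
  have : j = (Fin.last k).castSucc := Fin.ext (by simpa using hj)
  rwa [this]

theorem nbChoices_nonempty (hG : G.IsRegularOfDegree d) (hd : 2 ≤ d) {k : ℕ}
    (w : Fin (k + 1) → V) : (G.nbChoices w).Nonempty := by
  rw [← Finset.card_pos]
  rcases k with _ | k
  · rw [nbChoices_zero, card_neighborFinset_eq_degree, hG.degree_eq]; omega
  · rw [nbChoices_succ]
    have := Finset.pred_card_le_card_erase (s := G.neighborFinset (w (Fin.last (k + 1))))
      (a := w (Fin.last k).castSucc)
    rw [card_neighborFinset_eq_degree, hG.degree_eq] at this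
    omega

theorem nbNext_eq (hG : G.IsRegularOfDegree d) (hd : 2 ≤ d) {k : ℕ} (w : Fin (k + 1) → V) :
    G.nbNext w = PMF.uniformOfFinset (G.nbChoices w) (nbChoices_nonempty hG hd w) :=
  dif_pos _

theorem adj_of_mem_support_nbWalk (hG : G.IsRegularOfDegree d) (hd : 2 ≤ d) (v : V) (m : ℕ)
    {w : Fin (m + 1 + 1) → V} (hw : w ∈ (G.nbWalk v (m + 1)).support) :
    G.Adj (w (Fin.last m).castSucc) (w (Fin.last (m + 1))) := by
  rw [nbWalk, PMF.mem_support_bind_iff] at hw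
  obtain ⟨w', _, hw'⟩ := hw
  rw [PMF.mem_support_map_iff] at hw'
  obtain ⟨x, hx, rfl⟩ := hw'
  rw [nbNext_eq hG hd, PMF.mem_support_uniformOfFinset_iff] at hx
  rw [Fin.snoc_castSucc, Fin.snoc_last]
  simpa using (Finset.mem_filter.1 hx).1

theorem sum_nbWalk_succ (v : V) (m : ℕ) (F : (Fin (m + 1 + 1) → V) → ℂ) :
    ∑ w, ((G.nbWalk v (m + 1) w).toReal : ℂ) * F w
      = ∑ w, ((G.nbWalk v m w).toReal : ℂ)
        * ∑ x, ((G.nbNext w x).toReal : ℂ) * F (Fin.snoc (α := fun _ => V) w x) := by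
  rw [nbWalk, PMF.sum_toReal_bind]
  simp_rw [PMF.sum_toReal_map]

/-- Conditioning on all but the last step averages the last weight over the admissible
continuations, which is one application of the operator. -/
theorem sum_nbWalk_succ_succ (hG : G.IsRegularOfDegree d) (hd : 2 ≤ d) (v : V) (m : ℕ)
    (W : V → ℂ) (h : V → V → ℂ) :
    ∑ w, ((G.nbWalk v (m + 1 + 1) w).toReal : ℂ) * ((∏ j : Fin (m + 1 + 1), W (w j.succ))
        * h (w (Fin.last (m + 1)).castSucc) (w (Fin.last (m + 1 + 1))))
      = ∑ w, ((G.nbWalk v (m + 1) w).toReal : ℂ) * ((∏ j : Fin (m + 1), W (w j.succ))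
        * G.nbOp d ℂ (fun a b => W b * h a b) (w (Fin.last m).castSucc)
          (w (Fin.last (m + 1)))) := by
  rw [sum_nbWalk_succ]
  refine Finset.sum_congr rfl fun w _ => ?_
  by_cases hw : w ∈ (G.nbWalk v (m + 1)).support
  swap
  · rw [PMF.mem_support_iff, not_not] at hw
    simp [hw]
  have hadj := adj_of_mem_support_nbWalk hG hd v m hw
  congr 1
  rw [nbNext_eq hG hd, PMF.sum_toReal_uniformOfFinset, nbChoices_succ, nbOp_apply,
    Finset.card_erase_of_mem (by simpa using hadj.symm), card_neighborFinset_eq_degree,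
    hG.degree_eq, Nat.cast_sub (by omega), Nat.cast_one, Complex.real_smul,
    mul_left_comm (∏ j : Fin (m + 1), W (w j.succ))]
  push_cast
  congr 1
  rw [Finset.mul_sum]
  refine Finset.sum_congr rfl fun x _ => ?_
  rw [Fin.prod_univ_castSucc, Fin.succ_last, Fin.snoc_last, Fin.snoc_castSucc]
  simp_rw [Fin.succ_castSucc, Fin.snoc_castSucc (α := fun _ => V)]
  ring

/-- The multiplicative functionals of the law of the non-backtracking walk. -/
theorem sum_nbWalk_prod (hG : G.IsRegularOfDegree d) (hd : 2 ≤ d) (v : V) (m : ℕ) (W : V → ℂ) :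
    ∑ w, ((G.nbWalk v (m + 1) w).toReal : ℂ) * ∏ j : Fin (m + 1), W (w j.succ)
      = (d : ℂ)⁻¹ * ∑ b ∈ G.neighborFinset v, W b * G.nbGen d W m v b := by
  have hstep : ∀ m l, ∑ w, ((G.nbWalk v (m + 1) w).toReal : ℂ)
      * ((∏ j : Fin (m + 1), W (w j.succ))
        * G.nbGen d W l (w (Fin.last m).castSucc) (w (Fin.last (m + 1))))
      = (d : ℂ)⁻¹ * ∑ b ∈ G.neighborFinset v, W b * G.nbGen d W (m + l) v b := by
    intro m
    induction m with
    -- The first step has no predecessor, hence a uniform choice among `d` neighbours rather than `d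
    -- - 1`.
    | zero =>
      intro l
      rw [sum_nbWalk_succ]
      simp_rw [nbNext_eq hG hd, PMF.sum_toReal_uniformOfFinset]
      rw [nbWalk, PMF.sum_toReal_pure, nbChoices_zero, card_neighborFinset_eq_degree, hG.degree_eq]
      congr 1
      refine Finset.sum_congr rfl fun b _ => ?_
      rw [Fin.snoc_last, Fin.snoc_castSucc, zero_add l, Fin.prod_univ_one,
        show Fin.succ (0 : Fin 1) = Fin.last 1 from rfl, Fin.snoc_last]
    | succ m ih =>
      intro l
      rw [sum_nbWalk_succ_succ hG hd, ← show m + (l + 1) = m + 1 + l by omega, ← ih]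
      rfl
  simpa [nbGen] using hstep m 0

end WalkLaw

end SimpleGraph

/-! ### Characteristic functions on `ℕ^r` -/

section CharFun

variable {r : ℕ}

/-- A version of the **Lévy convergence theorem** for random vectors of natural numbers. -/
theorem MeasureTheory.ProbabilityMeasure.tendsto_of_tendsto_integral_cexp
    {ν : ℕ → ProbabilityMeasure (Fin r → ℕ)} {ν₀ : ProbabilityMeasure (Fin r → ℕ)}
    (h : ∀ t : Fin r → ℝ,
      Tendsto (fun k => ∫ x, Complex.exp ((∑ i, x i * t i : ℝ) * Complex.I)
          ∂(ν k : Measure (Fin r → ℕ))) atTop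
        (𝓝 (∫ x, Complex.exp ((∑ i, x i * t i : ℝ) * Complex.I) ∂(ν₀ : Measure (Fin r → ℕ))))) :
    Tendsto ν atTop (𝓝 ν₀) := by
  let emb : (Fin r → ℕ) → EuclideanSpace ℝ (Fin r) := fun x => WithLp.toLp 2 fun i => (x i : ℝ)
  have hemb : Measurable emb := Measurable.of_discrete
  let N : ProbabilityMeasure (Fin r → ℕ) → ProbabilityMeasure (EuclideanSpace ℝ (Fin r)) :=
    fun P => P.map hemb.aemeasurable
  have hchar : ∀ (P : ProbabilityMeasure (Fin r → ℕ)) (t : EuclideanSpace ℝ (Fin r)),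
      charFun (N P : Measure (EuclideanSpace ℝ (Fin r))) t
        = ∫ x, Complex.exp ((∑ i, x i * t i : ℝ) * Complex.I) ∂(P : Measure (Fin r → ℕ)) := by
    intro P t
    rw [charFun_apply, ProbabilityMeasure.toMeasure_map,
      integral_map hemb.aemeasurable (by fun_prop)]
    simp [emb, PiLp.inner_apply, mul_comm]
  have hlim : Tendsto (fun k => N (ν k)) atTop (𝓝 (N ν₀)) := by
    refine ProbabilityMeasure.tendsto_of_tendsto_charFun fun t => ?_
    simp_rw [hchar]
    exact h t
  refine tendsto_of_forall_isOpen_le_liminf' fun U _ => ?_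
  -- Distinct integer points are at distance at least 1, so this open set pulls back to exactly `U`,
  -- and the portmanteau inequality transfers to `ℕ^r`.
  let O : Set (EuclideanSpace ℝ (Fin r)) := ⋃ x ∈ U, Metric.ball (emb x) 1
  have hO : IsOpen O := isOpen_biUnion fun _ _ => Metric.isOpen_ball
  have hpre : emb ⁻¹' O = U := by
    ext y
    simp only [O, Set.mem_preimage, Set.mem_iUnion, exists_prop, Metric.mem_ball]
    refine ⟨fun ⟨x, hx, hxy⟩ => ?_, fun hy => ⟨y, hy, by simp⟩⟩
    suffices y = x by rwa [this]
    ext i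
    have h1 : dist (y i : ℝ) (x i : ℝ) < 1 := by
      refine lt_of_le_of_lt ?_ hxy
      rw [dist_eq_norm, dist_eq_norm]
      exact PiLp.norm_apply_le (emb y - emb x) i
    rw [Nat.dist_cast_real, Nat.dist_eq] at h1
    have h2 : |(y i : ℤ) - x i| < 1 := by exact_mod_cast h1
    have := Int.abs_lt_one_iff.1 h2
    omega
  have hval : ∀ P : ProbabilityMeasure (Fin r → ℕ),
      (N P : Measure (EuclideanSpace ℝ (Fin r))) O = (P : Measure (Fin r → ℕ)) U := by
    intro P
    rw [ProbabilityMeasure.toMeasure_map, Measure.map_apply hemb hO.measurableSet, hpre]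
  have := ProbabilityMeasure.le_liminf_measure_open_of_tendsto hlim hO
  simpa only [hval] using this

theorem integral_cexp_pi_poissonMeasure (μ : ℝ≥0) (t : Fin r → ℝ) :
    ∫ x, Complex.exp ((∑ i, x i * t i : ℝ) * Complex.I)
        ∂(Measure.pi fun _ : Fin r => poissonMeasure μ)
      = Complex.exp (μ * ∑ i, (Complex.exp (t i * Complex.I) - 1)) := by
  have e : ∀ x : Fin r → ℕ, Complex.exp ((∑ i, x i * t i : ℝ) * Complex.I)
      = ∏ i, Complex.exp ((x i * t i : ℝ) * Complex.I) := by
    intro x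
    rw [← Complex.exp_sum, Complex.ofReal_sum, Finset.sum_mul]
  simp_rw [e]
  rw [integral_fintype_prod_eq_prod (f := fun i (x : ℕ) => Complex.exp ((x * t i : ℝ) * Complex.I)),
    Finset.mul_sum, Complex.exp_sum]
  refine Finset.prod_congr rfl fun i _ => ?_
  rw [← charFun_map_cast_poissonMeasure, charFun_apply_real,
    integral_map .of_discrete (by fun_prop)]
  simp [mul_comm]

end CharFun

/-! ### Comparison for a single graph -/

namespace SimpleGraph

variable {V : Type*} [Fintype V] [DecidableEq V] {G : SimpleGraph V} [DecidableRel G.Adj] {d : ℕ}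

/-- A short path from `v l` can neither come back to `v l` nor reach another marked vertex. This
covers restarts on arrival at a marked vertex; the tail version covers the departure from the
starting vertex. -/
theorem nbOp_pow_headInd_eq_zero_of_head {ι : Type*} {g : ℕ} (hgirth : (g : ℕ∞) ≤ G.egirth)
    (v : ι → V) (hdist : ∀ i j, i ≠ j → g ≤ G.dist (v i) (v j)) {a : V} (l i : ι)
    (ha : G.Adj a (v l)) {j : ℕ} (hj : j + 2 < g) :
    (G.nbOp d ℝ ^ (j + 1)) (headInd (v i)) a (v l) = 0 := by
  by_contra h
  obtain ⟨p, hp, hpath⟩ := exists_isPath_of_nbOp_pow_ne_zero (v i) (j + 1) ha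
    (lt_of_lt_of_le (by exact_mod_cast hj) hgirth) h
  rw [Walk.cons_isPath_iff] at hpath
  by_cases hil : l = i
  · subst hil
    have := (Walk.isPath_iff_nil.1 hpath.1).length_eq_zero
    omega
  · have h1 := hdist l i hil
    have h2 := dist_le p
    omega

theorem nbOp_pow_headInd_eq_zero_of_tail {ι : Type*} {g : ℕ} (hgirth : (g : ℕ∞) ≤ G.egirth)
    (v : ι → V) (hdist : ∀ i j, i ≠ j → g ≤ G.dist (v i) (v j)) {b : V} (l i : ι)
    (hb : G.Adj (v l) b) {j : ℕ} (hj : j + 1 < g) :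
    (G.nbOp d ℝ ^ j) (headInd (v i)) (v l) b = 0 := by
  by_contra h
  obtain ⟨p, hp, hpath⟩ := exists_isPath_of_nbOp_pow_ne_zero (v i) j hb
    (lt_of_lt_of_le (by exact_mod_cast hj) hgirth) h
  by_cases hil : l = i
  · subst hil
    exact Walk.not_nil_cons (Walk.isPath_iff_nil.1 hpath)
  · have h1 := hdist l i hil
    have h2 := dist_le (Walk.cons hb p)
    rw [Walk.length_cons] at h2
    omega

/-- Comparison of the law of the visits with that of a walk with independent uniform steps, for a
single graph. -/
theorem norm_sum_nbWalk_prod_sub_le (hG : G.IsRegularOfDegree d) (hd : 2 ≤ d) {ι : Type*}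
    [Fintype ι] {g L n : ℕ} (hL : L + 2 ≤ g) (hn : 0 < n) (hgirth : (g : ℕ∞) ≤ G.egirth)
    (v : ι → V) (hdist : ∀ i j, i ≠ j → g ≤ G.dist (v i) (v j)) {s : ℕ → ℝ}
    (hs0 : ∀ j, 0 ≤ s j) (hs : Summable s)
    (hmix : ∀ u a b, G.Adj a b → ∀ j,
      |(G.nbOp d ℝ ^ (j + 1)) (headInd u) a b - (n : ℝ)⁻¹| ≤ s j)
    (z : ι → ℂ) {K : ℝ} (hK : 0 < K) (hz : ∑ i, ‖z i‖ ≤ K)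
    (hKε : K * (L / n + ∑' j, s (j + L)) ≤ 1 / 4) (i₀ : ι) (m : ℕ) :
    ‖∑ w, ((G.nbWalk (v i₀) (m + 1) w).toReal : ℂ)
        * ∏ j : Fin (m + 1), (1 + ∑ i, if w j.succ = v i then z i else 0)
      - (1 + (∑ i, z i) / n) ^ m‖
      ≤ 4 * (K * (L / n + ∑' j, s (j + L))) * (1 + 2 * K / n) ^ m := by
  have hn' : (0 : ℝ) < n := by exact_mod_cast hn
  have htail0 : ∀ j, 0 ≤ s (j + L) := fun j => hs0 _
  have hs' : Summable fun j => s (j + L) := (summable_nat_add_iff L).2 hs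
  have hε0 : 0 ≤ L / n + ∑' j, s (j + L) := add_nonneg (by positivity) (tsum_nonneg htail0)
  -- The walk has either just left its start or just reached a marked vertex. In both cases the
  -- first `L` visit probabilities vanish, each contributing `1 / n`, and mixing bounds the rest.
  let P : V → V → Prop := fun a b => a = v i₀ ∨ ∃ l, b = v l
  have hP : ∀ a b, G.Adj a b → P a b → ∀ i m, ∑ j ∈ Finset.range m,
      |(G.nbOp d ℝ ^ (j + 1)) (headInd (v i)) a b - (n : ℝ)⁻¹| ≤ L / n + ∑' j, s (j + L) := by
    intro a b hab hPab i m
    have hsmall : ∀ j < L, |(G.nbOp d ℝ ^ (j + 1)) (headInd (v i)) a b - (n : ℝ)⁻¹| = (n : ℝ)⁻¹ := by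
      intro j hj
      have : (G.nbOp d ℝ ^ (j + 1)) (headInd (v i)) a b = 0 := by
        rcases hPab with rfl | ⟨l, rfl⟩
        · exact nbOp_pow_headInd_eq_zero_of_tail hgirth v hdist i₀ i hab (by omega)
        · exact nbOp_pow_headInd_eq_zero_of_head hgirth v hdist l i hab (by omega)
      rw [this, zero_sub, abs_neg, abs_of_pos (inv_pos.2 hn')]
    refine (Finset.sum_le_sum_of_subset_of_nonneg (Finset.range_mono (Nat.le_add_left m L))
      fun _ _ _ => abs_nonneg _).trans ?_
    rw [Finset.sum_range_add]
    refine add_le_add ?_ ?_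
    · rw [Finset.sum_congr rfl fun j hj => hsmall j (Finset.mem_range.1 hj)]
      simp [div_eq_mul_inv]
    · refine le_trans (Finset.sum_le_sum fun j _ => ?_)
        (hs'.sum_le_tsum (Finset.range m) fun j _ => htail0 j)
      rw [add_comm L j]
      exact hmix (v i) a b hab (j + L)
  have hmain := norm_nbGen_sub_le hG hd v z hn' hK hz hε0 hKε P hP
    (fun a l _ => Or.inr ⟨l, rfl⟩) m
  have hd0 : (d : ℂ) ≠ 0 := by exact_mod_cast (by omega : d ≠ 0)
  rw [sum_nbWalk_prod hG hd (v i₀) m fun x => 1 + ∑ i, if x = v i then z i else 0]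
  set c : ℂ := 1 + (∑ i, z i) / n with hc
  -- The first step cannot hit a marked vertex, so its weight is 1 and only `m` of the `m + 1`
  -- factors count.
  have hone : ∀ b ∈ G.neighborFinset (v i₀), (1 + ∑ i, if b = v i then z i else 0) = (1 : ℂ) := by
    intro b hb
    rw [mem_neighborFinset] at hb
    rw [add_eq_left]
    refine Finset.sum_eq_zero fun i _ => if_neg fun hbi => ?_
    have := nbOp_pow_headInd_eq_zero_of_tail (d := d) hgirth v hdist i₀ i hb (j := 0) (by omega)
    simp [headInd, hbi] at this
  have hcard : ((G.neighborFinset (v i₀)).card : ℂ) = d := by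
    rw [card_neighborFinset_eq_degree, hG.degree_eq]
  have e : (d : ℂ)⁻¹ * ∑ b ∈ G.neighborFinset (v i₀), (1 + ∑ i, if b = v i then z i else 0)
        * G.nbGen d (fun x => 1 + ∑ i, if x = v i then z i else 0) m (v i₀) b - c ^ m
      = (d : ℂ)⁻¹ * ∑ b ∈ G.neighborFinset (v i₀),
        (G.nbGen d (fun x => 1 + ∑ i, if x = v i then z i else 0) m (v i₀) b - c ^ m) := by
    rw [Finset.sum_sub_distrib, Finset.sum_const, nsmul_eq_mul, hcard, mul_sub,
      inv_mul_cancel_left₀ hd0]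
    congr 2
    exact Finset.sum_congr rfl fun b hb => by rw [hone b hb, one_mul]
  rw [e, norm_mul, norm_inv, Complex.norm_natCast, inv_mul_le_iff₀ (by positivity)]
  refine (norm_sum_le_of_le _ fun b hb => hmain (v i₀) b (by simpa using hb) (Or.inl rfl)).trans ?_
  rw [Finset.sum_const, card_neighborFinset_eq_degree, hG.degree_eq, nsmul_eq_mul]

/-- By injectivity at most one index is active at each vertex, so the weight is `exp (i t_i)` at `v
i` and 1 elsewhere. -/
theorem cexp_visits_eq_prod {V : Type*} [DecidableEq V] {ι : Type*} [Fintype ι] {v : ι → V} (hv : Function.Injective v)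
    (t : ι → ℝ) {m : ℕ} (w : Fin (m + 1) → V) :
    Complex.exp ((∑ i, visits w (v i) * t i : ℝ) * Complex.I)
      = ∏ j : Fin m, (1 + ∑ i, if w j.succ = v i then Complex.exp (t i * Complex.I) - 1 else 0) := by
  classical
  have h1 : ∀ x, (1 + ∑ i, if x = v i then Complex.exp (t i * Complex.I) - 1 else 0)
      = Complex.exp (∑ i, (if x = v i then 1 else 0) * (t i * Complex.I)) := by
    intro x
    by_cases hx : ∃ i, x = v i
    · obtain ⟨i, rfl⟩ := hx
      simp [hv.eq_iff]
    · push Not at hx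
      simp [hx]
  simp_rw [h1]
  rw [← Complex.exp_sum, Finset.sum_comm]
  congr 1
  push_cast
  rw [Finset.sum_mul]
  refine Finset.sum_congr rfl fun i _ => ?_
  rw [← Finset.sum_mul, visits, Finset.card_filter]
  push_cast
  ring

end SimpleGraph

/-! ### Passage to the limit -/

theorem tendsto_one_add_div_pow_floor {μ : ℝ} (hμ : 0 < μ) {n : ℕ → ℕ}
    (hn : Tendsto n atTop atTop) (Z : ℂ) :
    Tendsto (fun k => (1 + Z / n k) ^ (⌊μ * n k⌋₊ - 1)) atTop (𝓝 (Complex.exp (μ * Z))) := by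
  have hnR : Tendsto (fun k => (n k : ℝ)) atTop atTop := tendsto_natCast_atTop_atTop.comp hn
  have hlog : Tendsto (fun k => (n k : ℂ) * Complex.log (1 + Z / n k)) atTop (𝓝 Z) := by
    have h := Complex.tendsto_mul_log_one_add_of_tendsto (g := fun x : ℝ => Z / x) (t := Z) (by
      refine tendsto_const_nhds.congr' ?_
      filter_upwards [eventually_ne_atTop 0] with x hx
      rw [mul_div_cancel₀]
      exact_mod_cast hx)
    exact (h.comp hnR).congr fun k => by simp
  have hratio : Tendsto (fun k => (((⌊μ * n k⌋₊ - 1 : ℕ) : ℝ) / n k)) atTop (𝓝 μ) := by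
    have h1 := (tendsto_nat_floor_mul_div_atTop hμ.le).comp hnR
    have h2 := h1.sub (tendsto_inv_atTop_zero.comp hnR)
    rw [sub_zero] at h2
    refine h2.congr' ?_
    filter_upwards [(tendsto_nat_floor_atTop.comp
      (hnR.const_mul_atTop hμ)).eventually_ge_atTop 1] with k hk
    simp only [Function.comp_apply] at hk ⊢
    rw [Nat.cast_sub hk, Nat.cast_one, sub_div, one_div]
  have hratioC : Tendsto (fun k => (((⌊μ * n k⌋₊ - 1 : ℕ) : ℂ) / n k)) atTop (𝓝 (μ : ℂ)) := by
    exact hratio.ofReal.congr fun k => by simp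
  refine ((Complex.continuous_exp.tendsto _).comp (hratioC.mul hlog)).congr' ?_
  have hne : ∀ᶠ k in atTop, 1 + Z / n k ≠ 0 := by
    have h0 : Tendsto (fun k => 1 + Z / (n k : ℂ)) atTop (𝓝 (1 + 0)) := by
      refine tendsto_const_nhds.add ?_
      have := (tendsto_inv_atTop_zero.comp hnR).ofReal.const_mul Z
      rw [Complex.ofReal_zero, mul_zero] at this
      exact this.congr fun k => by simp [div_eq_mul_inv]
    exact h0.eventually_ne (by simp)
  filter_upwards [hne, hn.eventually_gt_atTop 0] with k hk hk0
  have hk0' : (n k : ℂ) ≠ 0 := by exact_mod_cast hk0.ne'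
  rw [Function.comp_apply, ← mul_assoc, div_mul_cancel₀ _ hk0', Complex.exp_nat_mul,
    Complex.exp_log hk]

open SimpleGraph in
theorem SimpleGraph.tendsto_sum_nbWalk_cexp {d : ℕ} (hd : 3 ≤ d) {lam : ℝ} (hlam : lam < d)
    {r : ℕ} (hr : 0 < r) {μ : ℝ≥0} (hμ : 0 < μ)
    {V : ℕ → Type*} [∀ k, Fintype (V k)] [∀ k, DecidableEq (V k)]
    (G : ∀ k, SimpleGraph (V k)) [∀ k, DecidableRel (G k).Adj]
    {n : ℕ → ℕ} (hn : Tendsto n atTop atTop)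
    (hG : ∀ k, (G k).IsNDLambdaGraph (n k) d lam)
    {g : ℕ → ℕ} (hg : Tendsto g atTop atTop)
    (hgirth : ∀ k, (g k : ℕ∞) ≤ (G k).egirth)
    (v : ∀ k, Fin r → V k)
    (hdist : ∀ k, ∀ i j : Fin r, i ≠ j → g k ≤ (G k).dist (v k i) (v k j)) (t : Fin r → ℝ) :
    Tendsto (fun k => ∑ w, (((G k).nbWalk (v k ⟨0, hr⟩) ⌊(μ : ℝ) * n k⌋₊ w).toReal : ℂ)
        * Complex.exp ((∑ i, visits w (v k i) * t i : ℝ) * Complex.I)) atTop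
      (𝓝 (Complex.exp (μ * ∑ i, (Complex.exp (t i * Complex.I) - 1)))) := by
  obtain ⟨C, ρ, hC, hρ0, hρ1, hmix⟩ := IsNDLambdaGraph.exists_mixing hd hlam
  set z : Fin r → ℂ := fun i => Complex.exp (t i * Complex.I) - 1
  set s : ℕ → ℝ := fun j => C * (((j + 1 : ℕ) + 1) * ρ ^ (j + 1))
  have hs0 : ∀ j, 0 ≤ s j := fun j => by positivity
  have hs : Summable s := by
    have h1 : Summable fun j : ℕ => (j : ℝ) ^ 1 * ρ ^ j :=
      summable_pow_mul_geometric_of_norm_lt_one 1 (by rwa [Real.norm_of_nonneg hρ0.le])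
    have h2 : Summable fun j : ℕ => ρ ^ j := summable_geometric_of_lt_one hρ0.le hρ1
    have h3 : Summable fun j : ℕ => ((j : ℝ) + 1) * ρ ^ j :=
      (h1.add h2).congr fun j => by ring
    exact ((summable_nat_add_iff 1).2 h3).mul_left C
  -- Each of the `r` numbers `exp (i t_i) - 1` has norm at most 2.
  set K : ℝ := 2 * r with hKdef
  have hK : 0 < K := by positivity
  have hz : ∑ i, ‖z i‖ ≤ K := by
    calc ∑ i, ‖z i‖ ≤ ∑ _i : Fin r, (2 : ℝ) := by
          refine Finset.sum_le_sum fun i _ => (norm_sub_le _ _).trans ?_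
          rw [Complex.norm_exp_ofReal_mul_I, norm_one]
          norm_num
      _ = K := by simp [hKdef, mul_comm]
  have hnR : Tendsto (fun k => (n k : ℝ)) atTop atTop := tendsto_natCast_atTop_atTop.comp hn
  -- The cutoff must tend to infinity, satisfy `L + 2 ≤ g` eventually, and be negligible compared
  -- with `n`.
  let L : ℕ → ℕ := fun k => min (g k - 2) (n k).sqrt
  have hL : Tendsto L atTop atTop := by
    have hsqrt : Tendsto Nat.sqrt atTop atTop :=
      tendsto_atTop_atTop.2 fun b => ⟨b * b, fun a ha => Nat.le_sqrt.2 ha⟩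
    refine tendsto_atTop.2 fun b => ?_
    filter_upwards [((tendsto_sub_atTop_nat 2).comp hg).eventually_ge_atTop b,
      (hsqrt.comp hn).eventually_ge_atTop b] with k h1 h2 using le_min h1 h2
  have hLn : Tendsto (fun k => (L k : ℝ) / n k) atTop (𝓝 0) := by
    have h1 : Tendsto (fun k => (√(n k : ℝ))⁻¹) atTop (𝓝 0) :=
      tendsto_inv_atTop_zero.comp (Real.tendsto_sqrt_atTop.comp hnR)
    refine squeeze_zero' (Eventually.of_forall fun k => by positivity) ?_ h1
    filter_upwards [hn.eventually_gt_atTop 0] with k hk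
    have hk' : (0 : ℝ) < n k := by exact_mod_cast hk
    have h2 : (L k : ℝ) ≤ √(n k : ℝ) :=
      (Nat.cast_le.2 (min_le_right _ _)).trans Real.nat_sqrt_le_real_sqrt
    rw [div_le_iff₀ hk', inv_mul_eq_div, Real.div_sqrt]
    exact h2
  set ε : ℕ → ℝ := fun k => L k / n k + ∑' j, s (j + L k) with hε
  have hε0 : Tendsto ε atTop (𝓝 0) := by
    simpa using hLn.add ((tendsto_sum_nat_add s).comp hL)
  have hbound : ∀ᶠ k in atTop,
      ‖∑ w, (((G k).nbWalk (v k ⟨0, hr⟩) ⌊(μ : ℝ) * n k⌋₊ w).toReal : ℂ)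
          * Complex.exp ((∑ i, visits w (v k i) * t i : ℝ) * Complex.I)
        - (1 + (∑ i, z i) / n k) ^ (⌊(μ : ℝ) * n k⌋₊ - 1)‖
      ≤ 4 * (K * ε k) * Real.exp (2 * K * μ) := by
    have hKε : ∀ᶠ k in atTop, K * ε k ≤ 1 / 4 := by
      have := hε0.const_mul K
      rw [mul_zero] at this
      exact this.eventually_le_const (by norm_num)
    have hfloor : Tendsto (fun k => ⌊(μ : ℝ) * n k⌋₊) atTop atTop :=
      tendsto_nat_floor_atTop.comp (hnR.const_mul_atTop (by exact_mod_cast hμ))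
    filter_upwards [hKε, hn.eventually_gt_atTop 0, hg.eventually_ge_atTop 2,
      hfloor.eventually_ge_atTop 1] with k hKk hnk hgk hMk
    have hnk' : (0 : ℝ) < n k := by exact_mod_cast hnk
    have hinj : Function.Injective (v k) := by
      intro i j hij
      by_contra hne
      have := hdist k i j hne
      rw [hij, dist_self] at this
      omega
    have hMμ : ((⌊(μ : ℝ) * n k⌋₊ - 1 : ℕ) : ℝ) ≤ μ * n k :=
      (Nat.cast_le.2 (Nat.sub_le _ _)).trans (Nat.floor_le (by positivity))
    simp_rw [cexp_visits_eq_prod hinj]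
    generalize ⌊(μ : ℝ) * n k⌋₊ = M at hMk hMμ
    obtain ⟨m, rfl⟩ : ∃ m, M = m + 1 := ⟨M - 1, by omega⟩
    rw [Nat.add_sub_cancel] at hMμ ⊢
    refine (norm_sum_nbWalk_prod_sub_le (hG k).regular (by omega) (L := L k) (g := g k)
      (by have := min_le_left (g k - 2) (n k).sqrt; simp only [L]; omega) hnk (hgirth k) (v k)
      (hdist k) hs0 hs (fun u a b hab j => hmix (V k) (G k) (n k) (hG k) u a b hab (j + 1))
      z hK hz hKk ⟨0, hr⟩ m).trans ?_
    have hεk : 0 ≤ ε k := add_nonneg (by positivity) (tsum_nonneg fun j => hs0 _)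
    refine mul_le_mul_of_nonneg_left ?_ (by positivity)
    calc (1 + 2 * K / n k) ^ m ≤ Real.exp (2 * K / n k) ^ m := by
          gcongr
          rw [add_comm]
          exact Real.add_one_le_exp _
      _ = Real.exp (m * (2 * K / n k)) := (Real.exp_nat_mul _ _).symm
      _ ≤ Real.exp (2 * K * μ) := by
          refine Real.exp_le_exp.2 ?_
          calc m * (2 * K / n k) ≤ μ * n k * (2 * K / n k) := by gcongr
            _ = 2 * K * μ := by field_simp
  have hzero : Tendsto (fun k => 4 * (K * ε k) * Real.exp (2 * K * μ)) atTop (𝓝 0) := by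
    have := ((hε0.const_mul K).const_mul 4).mul_const (Real.exp (2 * K * μ))
    simpa using this
  have hdiff := squeeze_zero_norm' hbound hzero
  have hlim := tendsto_one_add_div_pow_floor (μ := μ) (by exact_mod_cast hμ) hn (∑ i, z i)
  simpa using hdiff.add hlim


theorem proposition3
    (d : ℕ) (hd : 3 ≤ d) (lam : ℝ) (hlam : lam < d)
    (r : ℕ) (hr : 0 < r) (μ : ℝ≥0) (hμ : 0 < μ)
    {V : ℕ → Type*} [∀ k, Fintype (V k)] [∀ k, DecidableEq (V k)]
    [∀ k, MeasurableSpace (V k)] [∀ k, DiscreteMeasurableSpace (V k)]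
    (G : ∀ k, SimpleGraph (V k)) [∀ k, DecidableRel (G k).Adj]
    (n : ℕ → ℕ) (hn : Tendsto n atTop atTop)
    (hG : ∀ k, (G k).IsNDLambdaGraph (n k) d lam)
    (g : ℕ → ℕ) (hg : Tendsto g atTop atTop)
    (hgirth : ∀ k, (g k : ℕ∞) ≤ (G k).egirth)
    (v : ∀ k, Fin r → V k)
    (hdist : ∀ k, ∀ i j : Fin r, i ≠ j → g k ≤ (G k).dist (v k i) (v k j)) :
    TendstoInDistribution
      (fun k (w : Fin (⌊(μ : ℝ) * n k⌋₊ + 1) → V k) (i : Fin r) => SimpleGraph.visits w (v k i))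
      atTop
      (fun z : Fin r → ℕ => z)
      (fun k => ((G k).nbWalk (v k ⟨0, hr⟩) ⌊(μ : ℝ) * n k⌋₊).toMeasure)
      (Measure.pi fun _ : Fin r => poissonMeasure μ) := by

  refine ⟨fun k => .of_discrete, aemeasurable_id, ?_⟩
  refine ProbabilityMeasure.tendsto_of_tendsto_integral_cexp fun t => ?_
  have hlim := SimpleGraph.tendsto_sum_nbWalk_cexp hd hlam hr hμ G hn hG hg hgirth v hdist t
  rw [← integral_cexp_pi_poissonMeasure] at hlim
  simp only [ProbabilityMeasure.coe_mk, Measure.map_id']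
  refine hlim.congr fun k => ?_
  rw [integral_map .of_discrete .of_discrete, PMF.integral_eq_sum]
  exact Finset.sum_congr rfl fun w _ => (Complex.real_smul ..).symm
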